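/- Let $R$ and $S$ be point robots in the plane with positions $p_R(t),p_S(t)$ and velocities $v_R(t),v_S(t)$, observed on a time interval $I$ with first element $0$ (bounded or unbounded), and suppose $p_R(0)\ne p_S(0)$. The robot $S$ is either stationary or non-cooperative, i.e. it moves with constant velocity. Put $x=p_S-p_R$, $v=v_S-v_R$, $r=\|x\|$, $V_{rel}=\|v\|$, let $\theta$ be the line-of-sight angle, $x=r(\cos\theta,\sin\theta)$, and let $$V_r=v\cdot(\cos\theta,\sin\theta),\qquad V_\theta=v\cdot(-\sin\theta,\cos\theta)$$ be the relative velocities in polar coordinates. For $\lambda>0$ the repulsive potential is $$U(x,v)=\lambda\,(\cos\gamma)^2\,\frac{\|v\|}{\|x\|}\ \text{ if } \tfrac{\pi}{2}<\gamma\le\pi,\qquad U(x,v)=0\ \text{ otherwise},$$ where $\gamma$ is the angle between $v$ and $x$ (and $U=0$ if $v=0$). The robot $R$ applies the vortex repulsive-field inputs, i.e. as long as no collision has occurred, $p_R$ is differentiable with $\dot p_R=v_R$ and its acceleration is $$\dot v_R=\Bigl(-\frac{\partial U}{\partial x_2}(x,v),\ +\frac{\partial U}{\partial x_1}(x,v)\Bigr);$$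 $p_R$ is continuous on $I$. Then: 1. At every time at which the field is active ($V_r<0$), $\dot r=V_r$ and the closed-loop relative dynamics are $$\dot V_r=\frac{V_\theta^2}{r}+2\Bigl(\frac{\lambda}{V_{rel}r^2}\Bigr)V_rV_\theta,\qquad \dot V_\theta=\frac{-V_rV_\theta}{r}+\Bigl(\frac{\lambda}{V_{rel}r^2}\Bigr)V_r^2 .$$ 2. The robots do not collide: there is $\delta>0$ with $r(t)\ge\delta$ for all $t\in I$. 3. If the robots are initially on a collision path, i.e. $V_r(0)<0$ and $V_\theta(0)=0$, then the collision conditions $V_r(t)<0$, $V_\theta(t)=0$ do not hold together at any $t\in I$ with $t>0$. -/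

import Mathlib

open Set

noncomputable section

/-- The Cartesian `X`-`Y` plane with its Euclidean norm. -/
abbrev Plane : Type := EuclideanSpace ℝ (Fin 2)

/-- A point robot moving in the plane: its position and its velocity as functions of time. -/
structure Robot where
  pos : ℝ → Plane
  vel : ℝ → Plane

/-- Position of `S` relative to `R` at time `t`. -/
def relPos (R S : Robot) (t : ℝ) : Plane := S.pos t - R.pos t

/-- Velocity of `S` relative to `R` at time `t`. -/
def relVel (R S : Robot) (t : ℝ) : Plane := S.vel t - R.vel t

/-- The line-of-sight angle of a relative position `x`, i.e. the angle that `x` makes with the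
`X`-axis (the four-quadrant inverse tangent of `x 1 / x 0`). -/
def losAngle (x : Plane) : ℝ := Complex.arg ⟨x 0, x 1⟩

/-- The radial component `V_r` of a relative velocity `v` at relative position `x`, along the
unit vector `(cos θ, sin θ)` of the line of sight. For velocities `V_k (cos φ_k, sin φ_k)` of the
two robots it is `V_j cos (φ_j - θ) - V_i cos (φ_i - θ)`. -/
def radialVel (x v : Plane) : ℝ :=
  v 0 * Real.cos (losAngle x) + v 1 * Real.sin (losAngle x)

/-- The component `V_θ` of a relative velocity `v` at relative position `x`, along the unit vector
`(-sin θ, cos θ)`. For velocities `V_k (cos φ_k, sin φ_k)` of the two robots it is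
`V_j sin (φ_j - θ) - V_i sin (φ_i - θ)`. -/
def transVel (x v : Plane) : ℝ :=
  -(v 0 * Real.sin (losAngle x)) + v 1 * Real.cos (losAngle x)

/-- The repulsive potential with gain `lam` at relative velocity `v` and relative position `x`:
`lam (cos γ)² ‖v‖ / ‖x‖` if the angle `γ` between `v` and `x` satisfies `π/2 < γ ≤ π`, and `0`
otherwise. (The angle is `π/2` by convention if `v = 0`, so the field is then not triggered.) -/
def repPotential (lam : ℝ) (v x : Plane) : ℝ :=
  if Real.pi / 2 < InnerProductGeometry.angle v x ∧ InnerProductGeometry.angle v x ≤ Real.pi then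
    lam * Real.cos (InnerProductGeometry.angle v x) ^ 2 * (‖v‖ / ‖x‖)
  else 0

/-- The `k`-th partial derivative of the repulsive potential with respect to the relative
position, the relative velocity being held fixed. -/
def repPartial (lam : ℝ) (v x : Plane) (k : Fin 2) : ℝ :=
  lineDeriv ℝ (fun y : Plane => repPotential lam v y) x (EuclideanSpace.single k 1)

/-- The vortex repulsive-field input `(F_x, F_y) = (-∂U/∂y, +∂U/∂x)`. -/
def vortexInput (lam : ℝ) (v x : Plane) : Plane :=
  !₂[-repPartial lam v x 1, repPartial lam v x 0]

/-- `S` is stationary during the time interval `I`. -/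
def IsStationaryRobot (I : Set ℝ) (S : Robot) : Prop :=
  ∀ t ∈ I, S.vel t = 0 ∧ S.pos t = S.pos 0

/-- `S` is non-cooperative during the time interval `I`: it moves at a constant velocity. -/
def IsNonCooperativeRobot (I : Set ℝ) (S : Robot) : Prop :=
  ∃ w : Plane, ∀ t ∈ I, S.vel t = w ∧ S.pos t = S.pos 0 + t • w

/-- `R` moves during the time interval `I` (with initial time `0`) under the vortex repulsive-field
inputs with gain `lam` generated by `S`. The inputs are only defined while the robots are apart, so
the equations of motion are imposed up to the first collision, if there is one; beyond that, only
continuity of the position is required. Derivatives are relative to `I`, hence one-sided at the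
initial time. -/
structure AppliesVortexInput (lam : ℝ) (I : Set ℝ) (R S : Robot) : Prop where
  continuousOn_pos : ContinuousOn R.pos I
  hasDeriv_pos : ∀ t ∈ I, (∀ s ∈ Icc 0 t, R.pos s ≠ S.pos s) →
    HasDerivWithinAt R.pos (R.vel t) I t
  hasDeriv_vel : ∀ t ∈ I, (∀ s ∈ Icc 0 t, R.pos s ≠ S.pos s) →
    HasDerivWithinAt R.vel (vortexInput lam (relVel R S t) (relPos R S t)) I t

/-- The robots are on a collision path at time `t`: `V_r < 0` and `V_θ = 0`. -/
def OnCollisionPath (R S : Robot) (t : ℝ) : Prop :=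
  radialVel (relPos R S t) (relVel R S t) < 0 ∧ transVel (relPos R S t) (relVel R S t) = 0

end

/-! Let `p = x · v` and `L = x × v`, so that `V_r = p / r` and `V_θ = L / r`. While `p < 0` the
potential is `lam p² / (V r³)`, and with `K = lam / (V r³)` the motion reads `r' = p / r`, `p' = V²
+ 2 K p L`, `L' = K p²`. Two facts carry the theorem. First, `L` strictly increases while the field
is active. Second, `p' ≥ c p` where `p < 0` on a compact collision-free interval, so the active
phase is an initial segment of the motion, after which `r` does not decrease
(`VortexMotion.dotMoment_neg_of_le`). Together they exclude a return to `p < 0`, `L = 0`.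

Hence only the approach phase can bring `r` near zero, and there `log r` is bounded below. If `L ≤
0` throughout, `-p - L - lam log r` does not increase. Otherwise `L ≥ c > 0` from some time on;
`antitoneOn_moment` then bounds `L` from above, and `p² - 2 L² - 2 c² log r` does not increase. The
bound is uniform on collision-free times, so continuity rules out a first collision. -/

/-! ### Monotone quantities and distance bounds in the approach phase -/

/-- The approach phase of a planar encounter in scalar form: `r` is the distance, `V` the relative
speed, `p` the scalar product and `L` the cross product of relative position and velocity. -/
structure ApproachPhase (lam : ℝ) (D : Set ℝ) (p L r V : ℝ → ℝ) : Prop where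
  convex : Convex ℝ D
  dist_pos : ∀ t ∈ D, 0 < r t
  speed_pos : ∀ t ∈ D, 0 < V t
  approaching : ∀ t ∈ D, p t < 0
  lagrange : ∀ t ∈ D, p t ^ 2 + L t ^ 2 = r t ^ 2 * V t ^ 2
  deriv_dist : ∀ t ∈ D, HasDerivWithinAt r (p t / r t) D t
  deriv_dot : ∀ t ∈ D,
    HasDerivWithinAt p (V t ^ 2 + 2 * (lam / (V t * r t ^ 3)) * p t * L t) D t
  deriv_cross : ∀ t ∈ D, HasDerivWithinAt L (lam / (V t * r t ^ 3) * p t ^ 2) D t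

theorem antitoneOn_of_hasDerivWithinAt_nonpos_on {D : Set ℝ} (hD : Convex ℝ D) {f f' : ℝ → ℝ}
    (hf : ∀ t ∈ D, HasDerivWithinAt f (f' t) D t) (hf' : ∀ t ∈ D, f' t ≤ 0) : AntitoneOn f D :=
  antitoneOn_of_hasDerivWithinAt_nonpos hD (fun t ht => (hf t ht).continuousWithinAt)
    (fun t ht => (hf t (interior_subset ht)).mono interior_subset)
    (fun t ht => hf' t (interior_subset ht))

namespace ApproachPhase

variable {lam : ℝ} {D : Set ℝ} {p L r V : ℝ → ℝ}

theorem mono (h : ApproachPhase lam D p L r V) {D' : Set ℝ} (hD' : Convex ℝ D') (hs : D' ⊆ D) :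
    ApproachPhase lam D' p L r V where
  convex := hD'
  dist_pos t ht := h.dist_pos t (hs ht)
  speed_pos t ht := h.speed_pos t (hs ht)
  approaching t ht := h.approaching t (hs ht)
  lagrange t ht := h.lagrange t (hs ht)
  deriv_dist t ht := (h.deriv_dist t (hs ht)).mono hs
  deriv_dot t ht := (h.deriv_dot t (hs ht)).mono hs
  deriv_cross t ht := (h.deriv_cross t (hs ht)).mono hs

theorem hasDeriv_log_dist (h : ApproachPhase lam D p L r V) {t : ℝ} (ht : t ∈ D) :
    HasDerivWithinAt (fun s => Real.log (r s)) (p t / r t ^ 2) D t := by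
  have := (h.deriv_dist t ht).log (h.dist_pos t ht).ne'
  convert this using 1
  rw [div_div, sq]

theorem antitoneOn_dist (h : ApproachPhase lam D p L r V) : AntitoneOn r D :=
  antitoneOn_of_hasDerivWithinAt_nonpos_on h.convex h.deriv_dist fun t ht =>
    (div_neg_of_neg_of_pos (h.approaching t ht) (h.dist_pos t ht)).le

theorem strictMonoOn_cross (h : ApproachPhase lam D p L r V) (hlam : 0 < lam) :
    StrictMonoOn L D := by
  refine strictMonoOn_of_hasDerivWithinAt_pos h.convex
    (fun t ht => (h.deriv_cross t ht).continuousWithinAt)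
    (fun t ht => (h.deriv_cross t (interior_subset ht)).mono interior_subset) fun t ht => ?_
  have htD := interior_subset ht
  have := h.dist_pos t htD
  have := h.speed_pos t htD
  have := sq_pos_of_neg (h.approaching t htD)
  positivity

theorem gain_mul_dist_mul_speed (h : ApproachPhase lam D p L r V) {t : ℝ} (ht : t ∈ D) :
    lam / (V t * r t ^ 3) * (r t * V t) = lam / r t ^ 2 := by
  have := h.dist_pos t ht
  have := h.speed_pos t ht
  field_simp

/-- While the cross product is nonpositive, the log-distance is controlled by `-p - L ≥ 0`. -/
theorem antitoneOn_of_cross_nonpos (h : ApproachPhase lam D p L r V) (hlam : 0 < lam)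
    (hL : ∀ t ∈ D, L t ≤ 0) :
    AntitoneOn (fun t => -p t - L t - lam * Real.log (r t)) D := by
  refine antitoneOn_of_hasDerivWithinAt_nonpos_on h.convex
    (fun t ht => (((h.deriv_dot t ht).neg.sub (h.deriv_cross t ht)).sub
      ((h.hasDeriv_log_dist ht).const_mul lam))) fun t ht => ?_
  have hr := h.dist_pos t ht
  have hV := h.speed_pos t ht
  have hp := h.approaching t ht
  have hLt := hL t ht
  have hN := h.lagrange t ht
  have hK : 0 < lam / (V t * r t ^ 3) := by positivity
  have hKN := h.gain_mul_dist_mul_speed ht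
  -- `r V = √(p² + L²) ≤ |p| + |L|`, and both moments are nonpositive.
  have hle : r t * V t ≤ -p t - L t := by
    refine abs_le_of_sq_le_sq' ?_ (by linarith) |>.2
    nlinarith
  have h1 : lam * (p t / r t ^ 2) = lam / (V t * r t ^ 3) * (r t * V t) * p t := by
    rw [hKN]; ring
  rw [h1]
  generalize lam / (V t * r t ^ 3) = K at *
  have h2 := mul_le_mul_of_nonneg_left hle (mul_pos hK (neg_pos.2 hp)).le
  have h3 := mul_nonneg hK.le (mul_nonneg_of_nonpos_of_nonpos hp.le hLt)
  nlinarith [sq_nonneg (V t)]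

/-- The derivative has the sign of `p (V² + 6 K p L + (9/4) lam² / r²)`. Since `2 |p L| ≤ r² V²` and
`K r² V² = lam V / r`, the bracket is at least `(V - (3/2) lam / r)²`; the constant `9/4` is what
completes this square. -/
theorem antitoneOn_moment (h : ApproachPhase lam D p L r V) (hlam : 0 < lam) :
    AntitoneOn (fun t => (p t ^ 2 + L t ^ 2 - 9 / 4 * lam ^ 2) / r t) D := by
  refine antitoneOn_of_hasDerivWithinAt_nonpos_on h.convex
    (fun t ht => (((((h.deriv_dot t ht).pow 2).add ((h.deriv_cross t ht).pow 2)).sub_const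
      (9 / 4 * lam ^ 2)).div (h.deriv_dist t ht) (h.dist_pos t ht).ne')) fun t ht => ?_
  have hr := h.dist_pos t ht
  have hV := h.speed_pos t ht
  have hp := h.approaching t ht
  have hN := h.lagrange t ht
  have hpL : -(2 * p t * L t) ≤ r t ^ 2 * V t ^ 2 := by nlinarith [sq_nonneg (p t + L t)]
  refine div_nonpos_of_nonpos_of_nonneg ?_ (sq_nonneg _)
  simp only [Pi.add_apply, Pi.pow_apply, Nat.cast_ofNat, Nat.add_one_sub_one, pow_one]
  have key : 0 ≤ V t ^ 2 + 6 * (lam / (V t * r t ^ 3)) * (p t * L t)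
      + 9 / 4 * lam ^ 2 / r t ^ 2 := by
    have h1 : 6 * (lam / (V t * r t ^ 3)) * (p t * L t)
        ≥ - (3 * (lam / (V t * r t ^ 3)) * (r t ^ 2 * V t ^ 2)) := by
      have hK : 0 < lam / (V t * r t ^ 3) := by positivity
      nlinarith [mul_le_mul_of_nonneg_left hpL hK.le]
    have h2 : V t ^ 2 - (3 * (lam / (V t * r t ^ 3)) * (r t ^ 2 * V t ^ 2))
      + 9 / 4 * lam ^ 2 / r t ^ 2 = (V t - 3 / 2 * lam / r t) ^ 2 := by
      field_simp
      ring
    nlinarith [sq_nonneg (V t - 3 / 2 * lam / r t)]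
  have h3 : (2 * p t * (V t ^ 2 + 2 * (lam / (V t * r t ^ 3)) * p t * L t)
      + 2 * L t * (lam / (V t * r t ^ 3) * p t ^ 2)) * r t
      - (p t ^ 2 + L t ^ 2 - 9 / 4 * lam ^ 2) * (p t / r t)
      = p t * r t * (V t ^ 2 + 6 * (lam / (V t * r t ^ 3)) * (p t * L t)
      + 9 / 4 * lam ^ 2 / r t ^ 2) := by
    rw [hN]
    field_simp
    ring
  rw [h3]
  exact mul_nonpos_of_nonpos_of_nonneg (mul_neg_of_neg_of_pos hp hr).le key

/-- The gain terms cancel in `p² - 2 L²`, leaving the derivative `2 p V²`; the logarithm is absorbed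
by `V² ≥ L² / r² ≥ c² / r²`. -/
theorem antitoneOn_of_le_cross (h : ApproachPhase lam D p L r V) {c : ℝ} (hc : 0 ≤ c)
    (hL : ∀ t ∈ D, c ≤ L t) :
    AntitoneOn (fun t => p t ^ 2 - 2 * L t ^ 2 - 2 * c ^ 2 * Real.log (r t)) D := by
  refine antitoneOn_of_hasDerivWithinAt_nonpos_on h.convex
    (fun t ht => ((((h.deriv_dot t ht).pow 2).sub (((h.deriv_cross t ht).pow 2).const_mul 2)).sub
      ((h.hasDeriv_log_dist ht).const_mul (2 * c ^ 2)))) fun t ht => ?_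
  have hr := h.dist_pos t ht
  have hp := h.approaching t ht
  have hN := h.lagrange t ht
  have hc2 : c ^ 2 / r t ^ 2 ≤ V t ^ 2 := by
    rw [div_le_iff₀ (by positivity)]
    nlinarith [pow_le_pow_left₀ hc (hL t ht) 2, sq_nonneg (p t)]
  simp only [Nat.cast_ofNat, Nat.add_one_sub_one, pow_one]
  have h3 : 2 * p t * (V t ^ 2 + 2 * (lam / (V t * r t ^ 3)) * p t * L t)
      - 2 * (2 * L t * (lam / (V t * r t ^ 3) * p t ^ 2)) - 2 * c ^ 2 * (p t / r t ^ 2)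
      = 2 * p t * (V t ^ 2 - c ^ 2 / r t ^ 2) := by ring
  rw [h3]
  exact mul_nonpos_of_nonpos_of_nonneg (by linarith) (by linarith)

theorem exists_pos_le_of_log_ge {D : Set ℝ} {r : ℝ → ℝ} (hr : ∀ t ∈ D, 0 < r t) {C : ℝ}
    (h : ∀ t ∈ D, C ≤ Real.log (r t)) : ∃ δ > 0, ∀ t ∈ D, δ ≤ r t :=
  ⟨Real.exp C, Real.exp_pos C, fun t ht => (Real.le_log_iff_exp_le (hr t ht)).1 (h t ht)⟩

theorem exists_pos_le_dist_of_cross_pos (h : ApproachPhase lam D p L r V) (hlam : 0 < lam)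
    {a : ℝ} (ha : IsLeast D a) (hLa : 0 < L a) : ∃ δ > 0, ∀ t ∈ D, δ ≤ r t := by
  -- Bound for `p² + L²`: the factor `r t / r a` from `antitoneOn_moment` is at most 1, and the
  -- absolute value covers either sign of the initial value.
  set B := 9 / 4 * lam ^ 2 + |p a ^ 2 + L a ^ 2 - 9 / 4 * lam ^ 2| with hB
  have hcross : ∀ t ∈ D, L a ≤ L t := fun t ht =>
    (h.strictMonoOn_cross hlam).monotoneOn ha.1 ht (ha.2 ht)
  have hbound : ∀ t ∈ D, L t ^ 2 ≤ B := by
    intro t ht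
    have hra := h.dist_pos a ha.1
    have hrt := h.dist_pos t ht
    have h1 := h.antitoneOn_moment hlam ha.1 ht (ha.2 ht)
    simp only at h1
    rw [div_le_div_iff₀ hrt hra] at h1
    have h2 : (p a ^ 2 + L a ^ 2 - 9 / 4 * lam ^ 2) * r t
        ≤ |p a ^ 2 + L a ^ 2 - 9 / 4 * lam ^ 2| * r a :=
      mul_le_mul (le_abs_self _) (h.antitoneOn_dist ha.1 ht (ha.2 ht)) hrt.le (abs_nonneg _)
    have h3 := le_of_mul_le_mul_right (h1.trans h2) hra
    nlinarith [sq_nonneg (p t)]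
  refine exists_pos_le_of_log_ge h.dist_pos
    (C := -(p a ^ 2 - 2 * L a ^ 2 - 2 * L a ^ 2 * Real.log (r a) + 2 * B) / (2 * L a ^ 2))
    fun t ht => ?_
  have h1 := h.antitoneOn_of_le_cross hLa.le hcross ha.1 ht (ha.2 ht)
  simp only at h1
  rw [div_le_iff₀ (by positivity)]
  nlinarith [hbound t ht, sq_nonneg (p t)]

theorem exists_pos_le_dist (h : ApproachPhase lam D p L r V) (hlam : 0 < lam)
    {a : ℝ} (ha : IsLeast D a) : ∃ δ > 0, ∀ t ∈ D, δ ≤ r t := by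
  by_cases hL : ∀ t ∈ D, L t ≤ 0
  · refine exists_pos_le_of_log_ge h.dist_pos
      (C := -(-p a - L a - lam * Real.log (r a)) / lam) fun t ht => ?_
    have h1 := h.antitoneOn_of_cross_nonpos hlam hL ha.1 ht (ha.2 ht)
    simp only at h1
    rw [div_le_iff₀ hlam]
    nlinarith [hL t ht, h.approaching t ht]
  · push Not at hL
    obtain ⟨b, hb, hLb⟩ := hL
    obtain ⟨δ, hδ, hle⟩ := (h.mono (h.convex.inter (convex_Ici b)) inter_subset_left)
      |>.exists_pos_le_dist_of_cross_pos hlam ⟨⟨hb, self_mem_Ici⟩, fun t ht => ht.2⟩ hLb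
    refine ⟨δ, hδ, fun t ht => ?_⟩
    rcases le_total b t with hbt | htb
    · exact hle t ⟨ht, hbt⟩
    · exact (hle b ⟨hb, self_mem_Ici⟩).trans (h.antitoneOn_dist ht hb htb)

end ApproachPhase

/-! ### A Grönwall-type sign argument -/

/-- A continuous function that satisfies `c f ≤ f'` where it is negative cannot become negative. -/
theorem forall_neg_of_neg_of_deriv_ge {f f' : ℝ → ℝ} {a b c : ℝ}
    (hf : ContinuousOn f (Icc a b))
    (hf' : ∀ t ∈ Icc a b, f t < 0 → HasDerivWithinAt f (f' t) (Icc a b) t)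
    (hle : ∀ t ∈ Icc a b, f t < 0 → c * f t ≤ f' t) (hb : f b < 0) :
    ∀ t ∈ Icc a b, f t < 0 := by
  intro s hs
  by_contra! hfs
  have hsub : Icc s b ⊆ Icc a b := Icc_subset_Icc_left hs.1
  have hZ : IsCompact {w ∈ Icc s b | 0 ≤ f w} :=
    isCompact_Icc.of_isClosed_subset
      ((hf.mono hsub).preimage_isClosed_of_isClosed isClosed_Icc isClosed_Ici) fun _ h => h.1
  -- After the last time `u` with `f ≥ 0`, the product `f t * exp (-c t)` is nondecreasing, so it
  -- cannot end negative.
  obtain ⟨u, ⟨hu, hfu⟩, hmax⟩ := hZ.exists_isGreatest ⟨s, ⟨le_rfl, hs.2⟩, hfs⟩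
  have hsubu : Icc u b ⊆ Icc a b := Icc_subset_Icc_left (hs.1.trans hu.1)
  have hneg : ∀ t ∈ Ioo u b, f t < 0 := fun t ht => by
    by_contra! h
    exact (hmax ⟨⟨hu.1.trans ht.1.le, ht.2.le⟩, h⟩).not_gt ht.1
  have hexp : ∀ t, HasDerivAt (fun t => Real.exp (-c * t)) (Real.exp (-c * t) * -c) t := fun t => by
    simpa using ((hasDerivAt_id t).const_mul (-c)).exp
  have hmono : MonotoneOn (fun t => f t * Real.exp (-c * t)) (Icc u b) := by
    refine monotoneOn_of_hasDerivWithinAt_nonneg (convex_Icc u b)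
      (f' := fun t => f' t * Real.exp (-c * t) + f t * (Real.exp (-c * t) * -c))
      ((hf.mono hsubu).mul (by fun_prop)) (fun t ht => ?_) fun t ht => ?_
    · have htI := hsubu (interior_subset ht)
      rw [interior_Icc] at ht ⊢
      exact ((hf' t htI (hneg t ht)).mono (Ioo_subset_Icc_self.trans hsubu)).mul
        (hexp t).hasDerivWithinAt
    · have htI := hsubu (interior_subset ht)
      rw [interior_Icc] at ht
      have := hle t htI (hneg t ht)
      nlinarith [Real.exp_pos (-c * t)]
  have h1 := hmono ⟨le_rfl, hu.2⟩ ⟨hu.2, le_rfl⟩ hu.2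
  have h2 : 0 ≤ f u * Real.exp (-c * u) := by positivity
  have h3 : f b * Real.exp (-c * b) < 0 := mul_neg_of_neg_of_pos hb (Real.exp_pos _)
  simp only at h1
  linarith

/-! ### Dot and cross moments, and the potential in terms of them -/

/-- The scalar product of relative position and relative velocity. -/
def dotMoment (x v : Plane) : ℝ := x 0 * v 0 + x 1 * v 1

/-- The cross product of relative position and relative velocity. -/
def crossMoment (x v : Plane) : ℝ := x 0 * v 1 - x 1 * v 0

theorem Plane.norm_sq (x : Plane) : ‖x‖ ^ 2 = x 0 ^ 2 + x 1 ^ 2 := by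
  rw [EuclideanSpace.norm_sq_eq, Fin.sum_univ_two, Real.norm_eq_abs, Real.norm_eq_abs, sq_abs,
    sq_abs]

theorem Plane.norm_eq_sqrt (x : Plane) : ‖x‖ = √(x 0 ^ 2 + x 1 ^ 2) := by
  rw [← Plane.norm_sq, Real.sqrt_sq (norm_nonneg x)]

theorem Plane.inner_eq_dotMoment (x v : Plane) : inner ℝ v x = dotMoment x v := by
  simp [PiLp.inner_apply, Fin.sum_univ_two, dotMoment]

theorem dotMoment_sq_add_crossMoment_sq (x v : Plane) :
    dotMoment x v ^ 2 + crossMoment x v ^ 2 = ‖x‖ ^ 2 * ‖v‖ ^ 2 := by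
  rw [Plane.norm_sq, Plane.norm_sq, dotMoment, crossMoment]
  ring

theorem norm_pos_of_dotMoment_neg {x v : Plane} (h : dotMoment x v < 0) : 0 < ‖x‖ ∧ 0 < ‖v‖ := by
  constructor <;> rw [norm_pos_iff] <;> rintro rfl <;> simp [dotMoment] at h

theorem cos_losAngle {x : Plane} (hx : x ≠ 0) : Real.cos (losAngle x) = x 0 / ‖x‖ := by
  have hz : (⟨x 0, x 1⟩ : ℂ) ≠ 0 := fun h => hx <| by
    ext i
    fin_cases i
    · exact congrArg Complex.re h
    · exact congrArg Complex.im h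
  rw [losAngle, Complex.cos_arg hz, Complex.norm_eq_sqrt_sq_add_sq, Plane.norm_eq_sqrt]

theorem sin_losAngle (x : Plane) : Real.sin (losAngle x) = x 1 / ‖x‖ := by
  rw [losAngle, Complex.sin_arg, Complex.norm_eq_sqrt_sq_add_sq, Plane.norm_eq_sqrt]

theorem radialVel_eq {x : Plane} (hx : x ≠ 0) (v : Plane) :
    radialVel x v = dotMoment x v / ‖x‖ := by
  rw [radialVel, cos_losAngle hx, sin_losAngle, dotMoment]
  ring

theorem transVel_eq {x : Plane} (hx : x ≠ 0) (v : Plane) :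
    transVel x v = crossMoment x v / ‖x‖ := by
  rw [transVel, cos_losAngle hx, sin_losAngle, crossMoment]
  ring

theorem radialVel_neg_iff {x : Plane} (hx : x ≠ 0) (v : Plane) :
    radialVel x v < 0 ↔ dotMoment x v < 0 := by
  rw [radialVel_eq hx, div_neg_iff]
  have := norm_pos_iff.2 hx
  constructor
  · rintro (h | h)
    · linarith
    · exact h.1
  · exact fun h => .inr ⟨h, this⟩

theorem repPotential_of_dotMoment_neg (lam : ℝ) {v x : Plane} (h : dotMoment x v < 0) :
    repPotential lam v x = lam / ‖v‖ * (dotMoment x v ^ 2 / ‖x‖ ^ 3) := by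
  obtain ⟨hx, hv⟩ := norm_pos_of_dotMoment_neg h
  have hcos : Real.cos (InnerProductGeometry.angle v x) = dotMoment x v / (‖v‖ * ‖x‖) := by
    rw [InnerProductGeometry.cos_angle, Plane.inner_eq_dotMoment]
  have hangle : Real.pi / 2 < InnerProductGeometry.angle v x := by
    by_contra! hle
    have h1 := Real.cos_nonneg_of_neg_pi_div_two_le_of_le
      (by linarith [InnerProductGeometry.angle_nonneg v x, Real.pi_pos]) hle
    rw [hcos] at h1
    exact h1.not_gt (div_neg_of_neg_of_pos h (by positivity))
  rw [repPotential, if_pos ⟨hangle, InnerProductGeometry.angle_le_pi v x⟩, hcos]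
  field_simp

theorem hasDerivAt_add_smul_single (x : Plane) (k i : Fin 2) :
    HasDerivAt (fun s : ℝ => (x + s • EuclideanSpace.single k (1 : ℝ)) i)
      (if i = k then 1 else 0) 0 := by
  simp only [PiLp.add_apply, PiLp.smul_apply, PiLp.single_apply, smul_eq_mul]
  simpa using ((hasDerivAt_id (0 : ℝ)).mul_const (if i = k then (1 : ℝ) else 0)).const_add (x i)

theorem HasDerivWithinAt.plane_norm {x : ℝ → Plane} {a b : ℝ} {D : Set ℝ} {t : ℝ}
    (h0 : HasDerivWithinAt (fun s => x s 0) a D t) (h1 : HasDerivWithinAt (fun s => x s 1) b D t)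
    (hx : x t ≠ 0) :
    HasDerivWithinAt (fun s => ‖x s‖) ((x t 0 * a + x t 1 * b) / ‖x t‖) D t := by
  have hpos := norm_pos_iff.2 hx
  have hne : x t 0 ^ 2 + x t 1 ^ 2 ≠ 0 := by rw [← Plane.norm_sq]; positivity
  have := ((h0.pow 2).add (h1.pow 2)).sqrt hne
  simp only [Plane.norm_eq_sqrt]
  refine HasDerivWithinAt.congr_deriv this ?_
  simp only [Pi.add_apply, Pi.pow_apply, ← Plane.norm_eq_sqrt]
  push_cast
  field_simp

/-- The condition `p < 0` is open in `x`, so near `x` the case distinction disappears and the smooth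
formula can be differentiated. -/
theorem repPartial_of_dotMoment_neg (lam : ℝ) {v x : Plane} (h : dotMoment x v < 0) (k : Fin 2) :
    repPartial lam v x k = lam / ‖v‖ *
      (2 * dotMoment x v * v k / ‖x‖ ^ 3 - 3 * dotMoment x v ^ 2 * x k / ‖x‖ ^ 5) := by
  obtain ⟨hx, hv⟩ := norm_pos_of_dotMoment_neg h
  set y : ℝ → Plane := fun s => x + s • EuclideanSpace.single k (1 : ℝ) with hy
  have hy0 : y 0 = x := by simp [hy]
  have hd := fun i => hasDerivAt_add_smul_single x k i
  have hp : HasDerivAt (fun s => dotMoment (y s) v) (v k) 0 := by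
    refine (((hd 0).mul_const (v 0)).add ((hd 1).mul_const (v 1))).congr_deriv ?_
    fin_cases k <;> simp
  have hn : HasDerivAt (fun s => ‖y s‖) (x k / ‖x‖) 0 := by
    rw [← hasDerivWithinAt_univ]
    refine (HasDerivWithinAt.plane_norm (x := y) (hd 0).hasDerivWithinAt
      (hd 1).hasDerivWithinAt (by rw [hy0]; exact norm_pos_iff.1 hx)).congr_deriv ?_
    rw [hy0]
    fin_cases k <;> simp
  have hquot := ((hp.pow 2).div (hn.pow 3) (by simp [hy0, hx.ne'])).const_mul (lam / ‖v‖)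
  have heq : (fun s => repPotential lam v (y s)) =ᶠ[nhds 0]
      fun s => lam / ‖v‖ * (dotMoment (y s) v ^ 2 / ‖y s‖ ^ 3) := by
    have hneg : ∀ᶠ s in nhds (0 : ℝ), dotMoment (y s) v < 0 :=
      hp.continuousAt.eventually_lt continuousAt_const (by rwa [hy0])
    filter_upwards [hneg] with s hs using repPotential_of_dotMoment_neg lam hs
  rw [repPartial, lineDeriv]
  refine (HasDerivAt.congr_of_eventuallyEq hquot heq).deriv.trans ?_
  simp only [Pi.pow_apply, hy0]
  push_cast
  field_simp

theorem vortexInput_apply_zero (lam : ℝ) {v x : Plane} (h : dotMoment x v < 0) :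
    vortexInput lam v x 0 = -(lam / ‖v‖ *
      (2 * dotMoment x v * v 1 / ‖x‖ ^ 3 - 3 * dotMoment x v ^ 2 * x 1 / ‖x‖ ^ 5)) := by
  rw [← repPartial_of_dotMoment_neg lam h]
  simp [vortexInput]

theorem vortexInput_apply_one (lam : ℝ) {v x : Plane} (h : dotMoment x v < 0) :
    vortexInput lam v x 1 = lam / ‖v‖ *
      (2 * dotMoment x v * v 0 / ‖x‖ ^ 3 - 3 * dotMoment x v ^ 2 * x 0 / ‖x‖ ^ 5) := by
  rw [← repPartial_of_dotMoment_neg lam h]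
  simp [vortexInput]

theorem HasDerivWithinAt.plane_apply {x : ℝ → Plane} {w : Plane} {D : Set ℝ} {t : ℝ}
    (hx : HasDerivWithinAt x w D t) (i : Fin 2) : HasDerivWithinAt (fun s => x s i) (w i) D t :=
  (PiLp.proj 2 (fun _ : Fin 2 => ℝ) i : Plane →L[ℝ] ℝ).hasFDerivAt.comp_hasDerivWithinAt t hx

/-! ### Evolution of distance and moments -/

section RelativeMotion

variable {lam : ℝ} {x v : ℝ → Plane} {D : Set ℝ} {t : ℝ}

theorem hasDerivWithinAt_norm_of_vel (hx : HasDerivWithinAt x (v t) D t) (hxt : x t ≠ 0) :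
    HasDerivWithinAt (fun s => ‖x s‖) (dotMoment (x t) (v t) / ‖x t‖) D t :=
  .plane_norm (hx.plane_apply 0) (hx.plane_apply 1) hxt

/-- The radial part of `∇U` is turned perpendicular to `x` and drops out; the part along `v` yields
the `p L` term. -/
theorem hasDerivWithinAt_dotMoment (hx : HasDerivWithinAt x (v t) D t)
    (hv : HasDerivWithinAt v (-vortexInput lam (v t) (x t)) D t)
    (h : dotMoment (x t) (v t) < 0) :
    HasDerivWithinAt (fun s => dotMoment (x s) (v s))
      (‖v t‖ ^ 2 + 2 * (lam / (‖v t‖ * ‖x t‖ ^ 3)) * dotMoment (x t) (v t)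
        * crossMoment (x t) (v t)) D t := by
  obtain ⟨hxp, hvp⟩ := norm_pos_of_dotMoment_neg h
  have hx' := hx.plane_apply
  have hv' := hv.plane_apply
  refine (((hx' 0).mul (hv' 0)).add ((hx' 1).mul (hv' 1))).congr_deriv ?_
  simp only [PiLp.neg_apply, vortexInput_apply_zero lam h, vortexInput_apply_one lam h,
    Plane.norm_sq (v t), crossMoment]
  field_simp
  ring

/-- The derivative is `U` itself: the quarter turn makes it `-x · ∇U`, and `U` is homogeneous of
degree `-1` in `x`. -/
theorem hasDerivWithinAt_crossMoment (hx : HasDerivWithinAt x (v t) D t)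
    (hv : HasDerivWithinAt v (-vortexInput lam (v t) (x t)) D t)
    (h : dotMoment (x t) (v t) < 0) :
    HasDerivWithinAt (fun s => crossMoment (x s) (v s))
      (lam / (‖v t‖ * ‖x t‖ ^ 3) * dotMoment (x t) (v t) ^ 2) D t := by
  obtain ⟨hxp, hvp⟩ := norm_pos_of_dotMoment_neg h
  have hx' := hx.plane_apply
  have hv' := hv.plane_apply
  refine (((hx' 0).mul (hv' 1)).sub ((hx' 1).mul (hv' 0))).congr_deriv ?_
  simp only [PiLp.neg_apply, vortexInput_apply_zero lam h, vortexInput_apply_one lam h]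
  have h1 : dotMoment (x t) (v t) = x t 0 * v t 0 + x t 1 * v t 1 := rfl
  have h2 := Plane.norm_sq (x t)
  field_simp
  generalize dotMoment (x t) (v t) = p at *
  generalize ‖x t‖ = r at *
  linear_combination (2 * lam * p * r ^ 2) * h1 - (3 * lam * p ^ 2) * h2
end RelativeMotion

/-! ### Collision-free relative motion -/

/-- Collision-free relative motion under the vortex input during the time interval `D`. -/
structure VortexMotion (lam : ℝ) (D : Set ℝ) (x v : ℝ → Plane) : Prop where
  convex : Convex ℝ D
  pos_ne_zero : ∀ t ∈ D, x t ≠ 0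
  deriv_pos : ∀ t ∈ D, HasDerivWithinAt x (v t) D t
  deriv_vel : ∀ t ∈ D, HasDerivWithinAt v (-vortexInput lam (v t) (x t)) D t

namespace VortexMotion

variable {lam : ℝ} {D : Set ℝ} {x v : ℝ → Plane}

theorem mono (h : VortexMotion lam D x v) {D' : Set ℝ} (hD' : Convex ℝ D') (hs : D' ⊆ D) :
    VortexMotion lam D' x v where
  convex := hD'
  pos_ne_zero t ht := h.pos_ne_zero t (hs ht)
  deriv_pos t ht := (h.deriv_pos t (hs ht)).mono hs
  deriv_vel t ht := (h.deriv_vel t (hs ht)).mono hs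

theorem continuousOn_pos (h : VortexMotion lam D x v) : ContinuousOn x D :=
  fun t ht => (h.deriv_pos t ht).continuousWithinAt

theorem continuousOn_dotMoment (h : VortexMotion lam D x v) :
    ContinuousOn (fun t => dotMoment (x t) (v t)) D := fun t ht => by
  have hx := fun i => ((h.deriv_pos t ht).plane_apply i).continuousWithinAt
  have hv := fun i => ((h.deriv_vel t ht).plane_apply i).continuousWithinAt
  exact ((hx 0).mul (hv 0)).add ((hx 1).mul (hv 1))

theorem approachPhase (h : VortexMotion lam D x v) (hp : ∀ t ∈ D, dotMoment (x t) (v t) < 0) :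
    ApproachPhase lam D (fun t => dotMoment (x t) (v t)) (fun t => crossMoment (x t) (v t))
      (fun t => ‖x t‖) (fun t => ‖v t‖) where
  convex := h.convex
  dist_pos t ht := (norm_pos_of_dotMoment_neg (hp t ht)).1
  speed_pos t ht := (norm_pos_of_dotMoment_neg (hp t ht)).2
  approaching := hp
  lagrange t _ := dotMoment_sq_add_crossMoment_sq (x t) (v t)
  deriv_dist t ht := hasDerivWithinAt_norm_of_vel (h.deriv_pos t ht) (h.pos_ne_zero t ht)
  deriv_dot t ht := hasDerivWithinAt_dotMoment (h.deriv_pos t ht) (h.deriv_vel t ht) (hp t ht)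
  deriv_cross t ht := hasDerivWithinAt_crossMoment (h.deriv_pos t ht) (h.deriv_vel t ht) (hp t ht)

theorem exists_pos_le_norm_of_compact (h : VortexMotion lam D x v) (hD : IsCompact D)
    (hne : D.Nonempty) : ∃ m > 0, ∀ t ∈ D, m ≤ ‖x t‖ := by
  obtain ⟨u, hu, hmin⟩ := hD.exists_isMinOn hne h.continuousOn_pos.norm
  exact ⟨‖x u‖, norm_pos_iff.2 (h.pos_ne_zero u hu), fun t ht => hmin ht⟩

/-- Once the field is inactive, it stays inactive: robots that approach each other at the end of
a time interval do so during the whole of it. -/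
theorem dotMoment_neg_of_le {a b : ℝ} (h : VortexMotion lam (Icc a b) x v) (hlam : 0 < lam)
    (hb : dotMoment (x b) (v b) < 0) : ∀ t ∈ Icc a b, dotMoment (x t) (v t) < 0 := by
  rcases lt_or_ge b a with hab | hab
  · simp [Icc_eq_empty_of_lt hab]
  obtain ⟨m, hm, hle⟩ := h.exists_pos_le_norm_of_compact isCompact_Icc ⟨a, le_rfl, hab⟩
  -- As `p < 0` and `L ≤ r V`, `p' ≥ 2 K p r V = 2 lam p / r² ≥ 2 lam p / m²`.
  refine forall_neg_of_neg_of_deriv_ge (c := 2 * lam / m ^ 2) h.continuousOn_dotMoment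
    (fun t ht hp => hasDerivWithinAt_dotMoment (h.deriv_pos t ht) (h.deriv_vel t ht) hp)
    (fun t ht hp => ?_) hb
  obtain ⟨hr, hV⟩ := norm_pos_of_dotMoment_neg hp
  have hN := dotMoment_sq_add_crossMoment_sq (x t) (v t)
  have hmr := hle t ht
  generalize dotMoment (x t) (v t) = p at *
  generalize crossMoment (x t) (v t) = L at *
  generalize ‖x t‖ = r at *
  generalize ‖v t‖ = V at *
  have hL : L ≤ r * V := abs_le_of_sq_le_sq' (by nlinarith [sq_nonneg p]) (by positivity) |>.2
  have h1 : 2 * lam / r ^ 2 * p ≤ 2 * (lam / (V * r ^ 3)) * p * L := by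
    have h2 : 2 * lam / r ^ 2 * p = 2 * (lam / (V * r ^ 3)) * p * (r * V) := by field_simp
    rw [h2]
    refine mul_le_mul_of_nonpos_left hL (mul_nonpos_of_nonneg_of_nonpos ?_ hp.le)
    positivity
  have h3 : 2 * lam / r ^ 2 ≤ 2 * lam / m ^ 2 := by gcongr
  nlinarith [mul_le_mul_of_nonpos_right h3 hp.le, sq_nonneg V]

theorem monotoneOn_norm (h : VortexMotion lam D x v)
    (hp : ∀ t ∈ D, 0 ≤ dotMoment (x t) (v t)) : MonotoneOn (fun t => ‖x t‖) D :=
  monotoneOn_of_hasDerivWithinAt_nonneg h.convex h.continuousOn_pos.norm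
    (fun t ht => (hasDerivWithinAt_norm_of_vel (h.deriv_pos t (interior_subset ht))
      (h.pos_ne_zero t (interior_subset ht))).mono interior_subset)
    fun t ht => div_nonneg (hp t (interior_subset ht)) (norm_nonneg _)

theorem exists_pos_le_norm (h : VortexMotion lam D x v) (hlam : 0 < lam) {a : ℝ}
    (ha : IsLeast D a) : ∃ δ > 0, ∀ t ∈ D, δ ≤ ‖x t‖ := by
  by_cases hp : ∀ t ∈ D, dotMoment (x t) (v t) < 0
  · exact (h.approachPhase hp).exists_pos_le_dist hlam ha
  push Not at hp
  obtain ⟨b, hb, hpb⟩ := hp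
  have hIcc : ∀ s ∈ D, ∀ t ∈ D, Icc s t ⊆ D := fun s hs t ht => h.convex.ordConnected.out hs ht
  have hmono := (h.mono (h.convex.inter (convex_Ici b)) inter_subset_left).monotoneOn_norm
    fun t ht => by
      by_contra! hpt
      exact hpb.not_gt ((h.mono (convex_Icc b t) (hIcc b hb t ht.1)).dotMoment_neg_of_le hlam hpt b
        ⟨le_rfl, ht.2⟩)
  obtain ⟨m, hm, hle⟩ := (h.mono (convex_Icc a b) (hIcc a ha.1 b hb)).exists_pos_le_norm_of_compact
    isCompact_Icc ⟨a, le_rfl, ha.2 hb⟩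
  refine ⟨m, hm, fun t ht => ?_⟩
  rcases le_total t b with htb | hbt
  · exact hle t ⟨ha.2 ht, htb⟩
  · exact (hle b ⟨ha.2 hb, le_rfl⟩).trans (hmono ⟨hb, self_mem_Ici⟩ ⟨ht, hbt⟩ hbt)

theorem hasDerivWithinAt_radialVel (h : VortexMotion lam D x v) {t : ℝ} (ht : t ∈ D)
    (hp : radialVel (x t) (v t) < 0) :
    HasDerivWithinAt (fun s => radialVel (x s) (v s))
      (transVel (x t) (v t) ^ 2 / ‖x t‖
        + 2 * (lam / (‖v t‖ * ‖x t‖ ^ 2)) * radialVel (x t) (v t) * transVel (x t) (v t)) D t := by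
  have hx := h.pos_ne_zero t ht
  rw [radialVel_neg_iff hx] at hp
  obtain ⟨hr, hV⟩ := norm_pos_of_dotMoment_neg hp
  have := (hasDerivWithinAt_dotMoment (h.deriv_pos t ht) (h.deriv_vel t ht) hp).div
    (hasDerivWithinAt_norm_of_vel (h.deriv_pos t ht) hx) hr.ne'
  refine (this.congr_of_mem (fun s hs => radialVel_eq (h.pos_ne_zero s hs) _) ht).congr_deriv ?_
  rw [radialVel_eq hx, transVel_eq hx]
  have hN := dotMoment_sq_add_crossMoment_sq (x t) (v t)
  field_simp
  -- Lagrange's identity turns `r² V² - p²` into `L²`.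
  linear_combination (-‖v t‖ * ‖x t‖) * hN

theorem hasDerivWithinAt_transVel (h : VortexMotion lam D x v) {t : ℝ} (ht : t ∈ D)
    (hp : radialVel (x t) (v t) < 0) :
    HasDerivWithinAt (fun s => transVel (x s) (v s))
      (-(radialVel (x t) (v t) * transVel (x t) (v t)) / ‖x t‖
        + lam / (‖v t‖ * ‖x t‖ ^ 2) * radialVel (x t) (v t) ^ 2) D t := by
  have hx := h.pos_ne_zero t ht
  rw [radialVel_neg_iff hx] at hp
  obtain ⟨hr, hV⟩ := norm_pos_of_dotMoment_neg hp
  have := (hasDerivWithinAt_crossMoment (h.deriv_pos t ht) (h.deriv_vel t ht) hp).div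
    (hasDerivWithinAt_norm_of_vel (h.deriv_pos t ht) hx) hr.ne'
  refine (this.congr_of_mem (fun s hs => transVel_eq (h.pos_ne_zero s hs) _) ht).congr_deriv ?_
  rw [radialVel_eq hx, transVel_eq hx]
  field_simp
  ring

end VortexMotion

/-! ### From the robots to their relative motion -/

theorem IsStationaryRobot.isNonCooperativeRobot {I : Set ℝ} {S : Robot}
    (hS : IsStationaryRobot I S) : IsNonCooperativeRobot I S :=
  ⟨0, fun t ht => by simpa using hS t ht⟩

theorem IsNonCooperativeRobot.hasDerivWithinAt_pos {I : Set ℝ} {S : Robot}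
    (hS : IsNonCooperativeRobot I S) {t : ℝ} (ht : t ∈ I) :
    HasDerivWithinAt S.pos (S.vel t) I t := by
  obtain ⟨w, hw⟩ := hS
  have : HasDerivWithinAt (fun s : ℝ => S.pos 0 + s • w) w I t := by
    simpa using ((hasDerivWithinAt_id t I).smul_const w).const_add (S.pos 0)
  rw [(hw t ht).1]
  exact this.congr_of_mem (fun s hs => (hw s hs).2) ht

theorem IsNonCooperativeRobot.hasDerivWithinAt_vel {I : Set ℝ} {S : Robot}
    (hS : IsNonCooperativeRobot I S) {t : ℝ} (ht : t ∈ I) : HasDerivWithinAt S.vel 0 I t := by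
  obtain ⟨w, hw⟩ := hS
  exact (hasDerivWithinAt_const t I w).congr_of_mem (fun s hs => (hw s hs).1) ht

/-- The times in `I` up to which the robots have not collided. -/
def collisionFreeTimes (I : Set ℝ) (R S : Robot) : Set ℝ :=
  {t ∈ I | ∀ s ∈ Icc 0 t, R.pos s ≠ S.pos s}

namespace AppliesVortexInput

variable {lam : ℝ} {I : Set ℝ} {R S : Robot}

theorem vortexMotion_collisionFreeTimes (hR : AppliesVortexInput lam I R S) (hI : I.OrdConnected)
    (hI0 : IsLeast I 0) (hS : IsNonCooperativeRobot I S) :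
    VortexMotion lam (collisionFreeTimes I R S) (relPos R S) (relVel R S) where
  convex := by
    refine OrdConnected.convex ⟨fun a ha b hb t ht => ⟨hI.out ha.1 hb.1 ht, fun s hs => ?_⟩⟩
    exact hb.2 s ⟨hs.1, hs.2.trans ht.2⟩
  pos_ne_zero t ht := sub_ne_zero.2 (ht.2 t ⟨hI0.2 ht.1, le_rfl⟩).symm
  deriv_pos t ht := ((hS.hasDerivWithinAt_pos ht.1).sub (hR.hasDeriv_pos t ht.1 ht.2)).mono
    fun _ h => h.1
  deriv_vel t ht := (((hS.hasDerivWithinAt_vel ht.1).sub (hR.hasDeriv_vel t ht.1 ht.2)).mono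
    fun _ h => h.1).congr_deriv (zero_sub _)

/-- At a first collision time `c` continuity forces the distance to tend to zero, while the uniform
bound on the collision-free times keeps it above some `δ > 0` on `[0, c)`. -/
theorem collisionFreeTimes_eq (hR : AppliesVortexInput lam I R S) (hlam : 0 < lam)
    (hI : I.OrdConnected) (hI0 : IsLeast I 0) (hS : IsNonCooperativeRobot I S)
    (h0 : R.pos 0 ≠ S.pos 0) : collisionFreeTimes I R S = I := by
  refine Subset.antisymm (fun _ h => h.1) fun T hT => ⟨hT, ?_⟩
  by_contra! hcol
  have hIT : Icc 0 T ⊆ I := hI.out hI0.1 hT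
  have hScont : ContinuousOn S.pos I := fun t ht =>
    (hS.hasDerivWithinAt_pos ht).continuousWithinAt
  have hcont : ContinuousOn (fun t => ‖relPos R S t‖) (Icc 0 T) :=
    ((hScont.sub hR.continuousOn_pos).mono hIT).norm
  have hZ : IsCompact {t ∈ Icc 0 T | ‖relPos R S t‖ = 0} :=
    isCompact_Icc.of_isClosed_subset
      (hcont.preimage_isClosed_of_isClosed isClosed_Icc isClosed_singleton) fun _ h => h.1
  obtain ⟨s, hs, hRS⟩ := hcol
  obtain ⟨c, ⟨hc, hrc⟩, hmin⟩ := hZ.exists_isLeast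
    ⟨s, hs, by rw [relPos, hRS, sub_self, norm_zero]⟩
  have hfree : ∀ t ∈ Ico 0 c, t ∈ collisionFreeTimes I R S := fun t ht => by
    refine ⟨hIT ⟨ht.1, ht.2.le.trans hc.2⟩, fun u hu heq => ?_⟩
    refine (hmin (a := u) ⟨⟨hu.1, hu.2.trans (ht.2.le.trans hc.2)⟩, ?_⟩).not_gt
      (hu.2.trans_lt ht.2)
    rw [relPos, heq, sub_self, norm_zero]
  have hc0 : 0 < c := by
    refine hc.1.lt_of_ne ?_
    rintro rfl
    rw [norm_eq_zero, relPos, sub_eq_zero] at hrc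
    exact h0 hrc.symm
  obtain ⟨δ, hδ, hle⟩ := (hR.vortexMotion_collisionFreeTimes hI hI0 hS).exists_pos_le_norm hlam
    ⟨hfree 0 ⟨le_rfl, hc0⟩, fun t ht => hI0.2 ht.1⟩
  have hlim : Filter.Tendsto (fun t => ‖relPos R S t‖) (nhdsWithin c (Ico 0 c)) (nhds 0) := by
    have := (hcont c hc).mono fun t (ht : t ∈ Ico 0 c) => ⟨ht.1, ht.2.le.trans hc.2⟩
    rwa [ContinuousWithinAt, hrc] at this
  have : (nhdsWithin c (Ico 0 c)).NeBot := by
    rw [← mem_closure_iff_nhdsWithin_neBot, closure_Ico hc0.ne]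
    exact ⟨hc0.le, le_rfl⟩
  exact hδ.not_ge (ge_of_tendsto hlim
    (eventually_mem_nhdsWithin.mono fun t ht => hle t (hfree t ht)))

theorem vortexMotion (hR : AppliesVortexInput lam I R S) (hlam : 0 < lam)
    (hI : I.OrdConnected) (hI0 : IsLeast I 0) (hS : IsNonCooperativeRobot I S)
    (h0 : R.pos 0 ≠ S.pos 0) : VortexMotion lam I (relPos R S) (relVel R S) := by
  have := hR.vortexMotion_collisionFreeTimes hI hI0 hS
  rwa [hR.collisionFreeTimes_eq hlam hI hI0 hS h0] at this

end AppliesVortexInput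

theorem theorem2 (lam : ℝ) (hlam : 0 < lam)
    (I : Set ℝ) (hI : I.OrdConnected) (hI0 : IsLeast I 0)
    (R S : Robot)
    (hS : IsStationaryRobot I S ∨ IsNonCooperativeRobot I S)
    (hR : AppliesVortexInput lam I R S)
    (h0 : R.pos 0 ≠ S.pos 0) :
    -- the closed-loop relative dynamics whenever the repulsive field is active
    (∀ t ∈ I, radialVel (relPos R S t) (relVel R S t) < 0 →
      HasDerivWithinAt (fun s => ‖relPos R S s‖)
        (radialVel (relPos R S t) (relVel R S t)) I t ∧
      HasDerivWithinAt (fun s => radialVel (relPos R S s) (relVel R S s))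
        (transVel (relPos R S t) (relVel R S t) ^ 2 / ‖relPos R S t‖
          + 2 * (lam / (‖relVel R S t‖ * ‖relPos R S t‖ ^ 2))
            * radialVel (relPos R S t) (relVel R S t)
            * transVel (relPos R S t) (relVel R S t)) I t ∧
      HasDerivWithinAt (fun s => transVel (relPos R S s) (relVel R S s))
        (-(radialVel (relPos R S t) (relVel R S t) * transVel (relPos R S t) (relVel R S t))
            / ‖relPos R S t‖
          + lam / (‖relVel R S t‖ * ‖relPos R S t‖ ^ 2)
            * radialVel (relPos R S t) (relVel R S t) ^ 2) I t) ∧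
    -- the robots do not collide: their distance stays bounded away from zero
    (∃ δ > 0, ∀ t ∈ I, δ ≤ ‖relPos R S t‖) ∧
    -- if they start on a collision path, they are never on a collision path again
    (OnCollisionPath R S 0 → ∀ t ∈ I, 0 < t → ¬ OnCollisionPath R S t) := by
  have hmot := hR.vortexMotion hlam hI hI0 (hS.elim (·.isNonCooperativeRobot) id) h0
  refine ⟨fun t ht hp => ⟨?_, hmot.hasDerivWithinAt_radialVel ht hp,
    hmot.hasDerivWithinAt_transVel ht hp⟩, hmot.exists_pos_le_norm hlam hI0, ?_⟩
  · rw [radialVel_eq (hmot.pos_ne_zero t ht)]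
    exact hasDerivWithinAt_norm_of_vel (hmot.deriv_pos t ht) (hmot.pos_ne_zero t ht)
  · rintro ⟨-, hL0⟩ t ht h0t ⟨hpt, hLt⟩
    have hx0 := hmot.pos_ne_zero 0 hI0.1
    have hxt := hmot.pos_ne_zero t ht
    rw [radialVel_neg_iff hxt] at hpt
    rw [transVel_eq hx0, div_eq_zero_iff, or_iff_left (norm_ne_zero_iff.2 hx0)] at hL0
    rw [transVel_eq hxt, div_eq_zero_iff, or_iff_left (norm_ne_zero_iff.2 hxt)] at hLt
    have hmot' := hmot.mono (convex_Icc 0 t) (hI.out hI0.1 ht)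
    have hlt := (hmot'.approachPhase (hmot'.dotMoment_neg_of_le hlam hpt)).strictMonoOn_cross hlam
      ⟨le_rfl, h0t.le⟩ ⟨h0t.le, le_rfl⟩ h0t
    simp only [hL0, hLt, lt_irrefl] at hlt
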